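/- Let $I\subseteq\mathbb{R}$ be a nonempty open interval, let $(F,g_F)$ be a connected smooth Riemannian manifold of dimension $m\ge 2$, and let $f\colon I\to(0,\infty)$ be smooth. Let $\overline{M}=I\times_f F$ be the generalized Robertson–Walker (GRW) spacetime with these data, that is, the manifold $I\times F$ with the Lorentzian metric $$\overline{g}=-\pi_I^*(dt^2)+f(\pi_I)^2\,\pi_F^*(g_F),$$ time-oriented by $\partial_t$. It is called non-contracting if $f'\ge 0$ on $I$ and non-expanding if $f'\le 0$ on $I$. Let $\psi\colon M^k\to\overline{M}$, $k\ge 1$, be a smooth immersion of a connected smooth manifold which is spacelike (the induced tensor $g=\psi^*\overline{g}$ is Riemannian). Its second fundamental form and mean curvature vector are $$\mathrm{II}(X,Y)=-\bigl(\overline{\nabla}_XY\bigr)^{\perp},\qquad \overrightarrow{H}=\tfrac1k\,\mathrm{trace}_g(\mathrm{II}),$$ where $\overline{\nabla}$ is the Levi-Civita connection of $\overline{g}$ and $\perp$ denotes the component normal to the submanifold (note the sign convention). The submanifold is weakly future (resp. past) trapped if, at every point of $M$, $\overrightarrow{H}$ is causal (i.e. $\overrightarrow{H}\neq 0$ and $\overline{g}(\overrightarrow{H},\overrightarrow{H})\le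 0$) and future pointing, $\overline{g}(\overrightarrow{H},\partial_t)<0$ (resp. past pointing, $\overline{g}(\overrightarrow{H},\partial_t)>0$). It is closed if $M$ is compact without boundary. Then: (i) If $\overline{M}$ is non-contracting, there are no closed weakly future trapped submanifolds in $\overline{M}$ (of any dimension $k\ge 1$). (ii) If $\overline{M}$ is non-expanding, there are no closed weakly past trapped submanifolds in $\overline{M}$ (of any dimension $k\ge 1$). -/

import Mathlib

open Set Manifold
open scoped ContDiff

noncomputable section

/-! ### Metric tensors and the Levi-Civita connection in charts -/

section Metric

variable {E H N : Type*} [NormedAddCommGroup E] [NormedSpace ℝ E] [TopologicalSpace H]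
  [TopologicalSpace N] [ChartedSpace H N] (I : ModelWithCorners ℝ E H)

/-- A field of bilinear forms on the tangent spaces of the manifold `N`
(no signature and no smoothness are imposed in this type). -/
abbrev MetricTensor (N : Type*) [TopologicalSpace N] [ChartedSpace H N] :=
  ∀ q : N, TangentSpace I q →L[ℝ] TangentSpace I q →L[ℝ] ℝ

variable {I}

/-- The coordinate expression of `g` in the preferred chart `φ` at `q`: at the point `y` of the
target of `φ` it is the bilinear form `(v, w) ↦ g (D(φ⁻¹)_y v, D(φ⁻¹)_y w)`, with coefficients
`g_{ij}(y)` in a basis of `E`. -/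
def MetricTensor.inChart (g : MetricTensor I N) (q : N) (y : E) : E →L[ℝ] E →L[ℝ] ℝ :=
  let A : E →L[ℝ] E := mfderiv 𝓘(ℝ, E) I (extChartAt I q).symm y
  let b : E →L[ℝ] E →L[ℝ] ℝ := g ((extChartAt I q).symm y)
  b.bilinearComp A A

/-- The Christoffel symbols of the first kind at `q`, in the preferred chart at `q`:
the linear form `z ↦ (∂_v g(w, z) + ∂_w g(v, z) - ∂_z g(v, w)) / 2`
(for constant coordinate fields `v, w, z`). -/
def MetricTensor.christoffelFirst (g : MetricTensor I N) (q : N) (v w : E) : E →L[ℝ] ℝ :=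
  let D : E →L[ℝ] E →L[ℝ] E →L[ℝ] ℝ := fderiv ℝ (MetricTensor.inChart g q) (extChartAt I q q)
  (1 / 2 : ℝ) • (D v w + D w v - (D.flip v).flip w)

/-- The Christoffel symbols of the Levi-Civita connection of `g` at `q`, in the preferred chart
at `q`: `Γ(v, w)` is obtained from the symbols of the first kind by raising the index with the
inverse of the metric (so, `g` being nondegenerate, `g(Γ(v, w), z)` is the value at `z` of the
symbols of the first kind); i.e. `Γ(∂_i, ∂_j) = ∇_{∂_i} ∂_j` at `q`. -/
def MetricTensor.christoffel (g : MetricTensor I N) (q : N) (v w : E) : E :=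
  (MetricTensor.inChart g q (extChartAt I q q)).inverse (MetricTensor.christoffelFirst g q v w)

end Metric

/-! ### Spacelike immersed submanifolds and their mean curvature vector -/

section Submanifold

variable {E H N : Type*} [NormedAddCommGroup E] [NormedSpace ℝ E] [TopologicalSpace H]
  [TopologicalSpace N] [ChartedSpace H N] {I : ModelWithCorners ℝ E H} (g : MetricTensor I N)
  {k : ℕ} {M : Type*} [TopologicalSpace M] [ChartedSpace (EuclideanSpace ℝ (Fin k)) M]
  (ψ : M → N)

/-- `ψ` is a smooth spacelike immersion into `(N, g)`: the induced bilinear form `ψ^* g` is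
positive definite on every tangent space (in particular every `dψ_p` is injective). -/
def IsSpacelikeImmersion : Prop :=
  ContMDiff (𝓡 k) I ∞ ψ ∧
    ∀ (p : M) (u : TangentSpace (𝓡 k) p), u ≠ 0 →
      0 < g (ψ p) (mfderiv (𝓡 k) I ψ p u) (mfderiv (𝓡 k) I ψ p u)

variable (p : M)

/-- The coordinate vector `∂_i` at `p` of the preferred chart at `p`. -/
def coordVec (i : Fin k) : TangentSpace (𝓡 k) p :=
  (EuclideanSpace.single i (1 : ℝ) : EuclideanSpace ℝ (Fin k))

/-- The matrix `g_{ij} = g(dψ ∂_i, dψ ∂_j)` of the induced metric at `p`. -/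
def inducedGram : Matrix (Fin k) (Fin k) ℝ :=
  Matrix.of fun i j =>
    g (ψ p) (mfderiv (𝓡 k) I ψ p (coordVec p i)) (mfderiv (𝓡 k) I ψ p (coordVec p j))

/-- The component `w^⊥` of `w ∈ T_{ψ(p)} N` normal to `dψ(T_p M)`:
`w - ∑_{i,j} g^{ij} g(w, dψ ∂_i) dψ ∂_j`. -/
def normalPart (w : TangentSpace I (ψ p)) : TangentSpace I (ψ p) :=
  w - ∑ i : Fin k, ∑ j : Fin k,
    ((inducedGram g ψ p)⁻¹ i j * g (ψ p) w (mfderiv (𝓡 k) I ψ p (coordVec p i))) •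
      mfderiv (𝓡 k) I ψ p (coordVec p j)

/-- The ambient covariant derivative `∇̄_u (dψ V)` at `p`, where `V` is the vector field with
constant coefficients `v` in the preferred chart of `M` at `p`:
`D²ψ(u, v) + Γ(dψ u, dψ v)`, computed in the preferred charts at `p` and `ψ p` (with respect to
which the tangent spaces at `p` and `ψ p` are identified with the model spaces). -/
def ambientCovDeriv (u v : TangentSpace (𝓡 k) p) : TangentSpace I (ψ p) :=
  let hess : E := fderiv ℝ (fun x : EuclideanSpace ℝ (Fin k) =>
    fderiv ℝ (writtenInExtChartAt (𝓡 k) I p ψ) x v) (extChartAt (𝓡 k) p p) u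
  let u' : E := mfderiv (𝓡 k) I ψ p u
  let v' : E := mfderiv (𝓡 k) I ψ p v
  (hess + MetricTensor.christoffel g (ψ p) u' v' : E)

/-- The second fundamental form with the sign convention of General Relativity,
`II(u, v) = -(∇̄_u v)^⊥`. -/
def secondFundamentalForm (u v : TangentSpace (𝓡 k) p) : TangentSpace I (ψ p) :=
  -normalPart (k := k) g ψ p (ambientCovDeriv (k := k) g ψ p u v)

/-- The mean curvature vector `H = (1/k) trace II = (1/k) ∑_{i,j} g^{ij} II(∂_i, ∂_j)`. -/
def meanCurvature : TangentSpace I (ψ p) :=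
  (1 / (k : ℝ)) • ∑ i : Fin k, ∑ j : Fin k,
    (inducedGram g ψ p)⁻¹ i j • secondFundamentalForm (k := k) g ψ p (coordVec p i) (coordVec p j)

end Submanifold

/-! ### Generalized Robertson-Walker spacetimes -/

/-- The data of a generalized Robertson-Walker spacetime `I ×_f F` with fiber an `m`-dimensional
manifold `F`: a nonempty open interval `I ⊆ ℝ`, a positive smooth warping function `f` on `I`
(its values outside `I` are irrelevant) and a Riemannian metric `g_F` on `F`.
The spacetime is the open subset `I × F` of the manifold `ℝ × F`. -/
structure GRWSpacetime (m : ℕ) (F : Type*) [TopologicalSpace F]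
    [ChartedSpace (EuclideanSpace ℝ (Fin m)) F] [IsManifold (𝓡 m) ∞ F] where
  /-- the interval of times -/
  I : Set ℝ
  isOpen_I : IsOpen I
  ordConnected_I : I.OrdConnected
  nonempty_I : I.Nonempty
  /-- the warping function -/
  f : ℝ → ℝ
  contDiffOn_f : ContDiffOn ℝ ∞ f I
  f_pos : ∀ t ∈ I, 0 < f t
  /-- the Riemannian metric of the fiber -/
  gF : Bundle.ContMDiffRiemannianMetric (𝓡 m) ∞ (EuclideanSpace ℝ (Fin m))
    (fun x : F => TangentSpace (𝓡 m) x)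

namespace GRWSpacetime

variable {m : ℕ} {F : Type*} [TopologicalSpace F] [ChartedSpace (EuclideanSpace ℝ (Fin m)) F]
  [IsManifold (𝓡 m) ∞ F] (S : GRWSpacetime m F)

/-- The set of events, `I × F ⊆ ℝ × F`. -/
def carrier : Set (ℝ × F) := S.I ×ˢ univ

/-- The Lorentzian metric `-π_I^*(dt²) + f(π_I)² π_F^*(g_F)`. -/
def metric : MetricTensor (𝓘(ℝ, ℝ).prod (𝓡 m)) (ℝ × F) := fun q =>
  let E := EuclideanSpace ℝ (Fin m)
  let dπI : ℝ × E →L[ℝ] ℝ :=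
    mfderiv (𝓘(ℝ, ℝ).prod (𝓡 m)) 𝓘(ℝ, ℝ) (Prod.fst : ℝ × F → ℝ) q
  let dπF : ℝ × E →L[ℝ] E :=
    mfderiv (𝓘(ℝ, ℝ).prod (𝓡 m)) (𝓡 m) (Prod.snd : ℝ × F → F) q
  let h : E →L[ℝ] E →L[ℝ] ℝ := S.gF.inner q.2
  let dtSq : ℝ × E →L[ℝ] ℝ × E →L[ℝ] ℝ := (ContinuousLinearMap.mul ℝ ℝ).bilinearComp dπI dπI
  (-dtSq + S.f q.1 ^ 2 • h.bilinearComp dπF dπF : ℝ × E →L[ℝ] ℝ × E →L[ℝ] ℝ)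

/-- The vector field `∂_t` on `ℝ × F`, which defines the time orientation. -/
def dt (q : ℝ × F) : TangentSpace (𝓘(ℝ, ℝ).prod (𝓡 m)) q :=
  ((1 : ℝ), (0 : EuclideanSpace ℝ (Fin m)))

/-- A tangent vector is causal if it is nonzero and timelike or lightlike. -/
def IsCausal {q : ℝ × F} (v : TangentSpace (𝓘(ℝ, ℝ).prod (𝓡 m)) q) : Prop :=
  v ≠ 0 ∧ S.metric q v v ≤ 0

/-- A (causal) vector is future pointing if it lies in the same half of the causal cone
as `∂_t`. -/
def IsFuturePointing {q : ℝ × F} (v : TangentSpace (𝓘(ℝ, ℝ).prod (𝓡 m)) q) : Prop :=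
  S.metric q v (dt q) < 0

/-- A (causal) vector is past pointing if it lies in the same half of the causal cone
as `-∂_t`. -/
def IsPastPointing {q : ℝ × F} (v : TangentSpace (𝓘(ℝ, ℝ).prod (𝓡 m)) q) : Prop :=
  0 < S.metric q v (dt q)

/-- The comoving observers do not come together: `f' ≥ 0` on `I`. -/
def IsNonContracting : Prop := ∀ t ∈ S.I, 0 ≤ deriv S.f t

/-- The comoving observers do not spread out: `f' ≤ 0` on `I`. -/
def IsNonExpanding : Prop := ∀ t ∈ S.I, deriv S.f t ≤ 0

variable {k : ℕ} {M : Type*} [TopologicalSpace M] [ChartedSpace (EuclideanSpace ℝ (Fin k)) M]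
  (ψ : M → ℝ × F)

/-- `ψ` is an immersed spacelike submanifold of the spacetime `I ×_f F`. -/
def IsSpacelikeSubmanifold : Prop :=
  (∀ p, ψ p ∈ S.carrier) ∧ IsSpacelikeImmersion (k := k) S.metric ψ

/-- `ψ` is weakly future trapped: a spacelike submanifold whose mean curvature vector is
everywhere causal and future pointing. -/
def IsWeaklyFutureTrapped : Prop :=
  S.IsSpacelikeSubmanifold (k := k) ψ ∧
    ∀ p, S.IsCausal (meanCurvature (k := k) S.metric ψ p) ∧ S.IsFuturePointing (meanCurvature (k := k) S.metric ψ p)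

/-- `ψ` is weakly past trapped: a spacelike submanifold whose mean curvature vector is
everywhere causal and past pointing. -/
def IsWeaklyPastTrapped : Prop :=
  S.IsSpacelikeSubmanifold (k := k) ψ ∧
    ∀ p, S.IsCausal (meanCurvature (k := k) S.metric ψ p) ∧ S.IsPastPointing (meanCurvature (k := k) S.metric ψ p)

end GRWSpacetime

end

/-!
Let `τ = π_I ∘ ψ` be the time function along `ψ`. Since `M` is compact, `τ` attains its minimum at
some `p`. There `dτ = 0`, so `∂_t` is normal to the submanifold and pairing the second fundamental
form with it needs no projection:
`ḡ(II(u, v), ∂_t) = -ḡ(∇̄_u v, ∂_t) = Hess τ(u, v) + f f' g_F(dψ u, dψ v)`,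
the last summand coming from the only Christoffel symbols with a time component. At a minimum
`Hess τ ≥ 0`, so if `f' ≥ 0` the trace gives `ḡ(H, ∂_t) ≥ 0` and `H` is not future pointing at `p`.
At a maximum all signs are reversed.
-/

open Filter Topology

section SecondDerivativeTest

variable {V : Type*} [NormedAddCommGroup V] [NormedSpace ℝ V]

theorem deriv_deriv_nonneg_of_isLocalMin {f : ℝ → ℝ} {a : ℝ} (h : IsLocalMin f a)
    (hf : ContinuousAt f a) : 0 ≤ deriv (deriv f) a := by
  by_contra! hneg
  have hmax : IsLocalMax f a := isLocalMax_of_deriv_deriv_neg hneg h.deriv_eq_zero hf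
  have hconst : f =ᶠ[𝓝 a] fun _ => f a := by
    filter_upwards [h, hmax] with x hle hge using le_antisymm hge hle
  have hzero : deriv (deriv f) a = 0 := by simpa using hconst.deriv.deriv_eq
  exact hneg.ne hzero

theorem fderiv_fderiv_nonneg_of_isLocalMin {h : V → ℝ} {x : V} (hx : IsLocalMin h x)
    (hh : ContDiffAt ℝ 2 h x) (v : V) : 0 ≤ fderiv ℝ (fderiv ℝ h) x v v := by
  have hline : Tendsto (fun s : ℝ => x + s • v) (𝓝 0) (𝓝 x) :=
    Continuous.tendsto' (by fun_prop) _ _ (by simp)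
  have hmin : IsLocalMin (fun s : ℝ => h (x + s • v)) 0 := by
    simpa [IsLocalMin, IsMinFilter] using hline.eventually hx
  have hfirst : deriv (fun s : ℝ => h (x + s • v)) =ᶠ[𝓝 0] fun s => fderiv ℝ h (x + s • v) v := by
    filter_upwards [hline.eventually (hh.eventually (by simp))] with s hs
    have hl : HasDerivAt (fun s : ℝ => x + s • v) v s := by
      simpa using ((hasDerivAt_id s).smul_const v).const_add x
    exact ((hs.differentiableAt two_ne_zero).hasFDerivAt.comp_hasDerivAt s hl).deriv
  have hsecond : HasDerivAt (fun s : ℝ => fderiv ℝ h (x + s • v) v)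
      (fderiv ℝ (fderiv ℝ h) x v v) 0 := by
    have hd : DifferentiableAt ℝ (fderiv ℝ h) x :=
      (hh.fderiv_right (m := 1) (by norm_num)).differentiableAt one_ne_zero
    have hdir : HasLineDerivAt ℝ (fun y => fderiv ℝ h y v) (fderiv ℝ (fderiv ℝ h) x v v) x v := by
      simpa using (hd.hasFDerivAt.clm_apply (hasFDerivAt_const v x)).hasLineDerivAt v
    exact hdir
  rw [← hsecond.deriv, ← hfirst.deriv_eq]
  refine deriv_deriv_nonneg_of_isLocalMin hmin ?_
  exact ContinuousAt.comp_of_eq hh.continuousAt (by fun_prop) (by simp)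

theorem fderiv_fderiv_nonpos_of_isLocalMax {h : V → ℝ} {x : V} (hx : IsLocalMax h x)
    (hh : ContDiffAt ℝ 2 h x) (v : V) : fderiv ℝ (fderiv ℝ h) x v v ≤ 0 := by
  have hneg : fderiv ℝ (fun y => -h y) = fun y => -fderiv ℝ h y := funext fun _ => fderiv_fun_neg
  simpa [hneg, fderiv_fun_neg] using fderiv_fderiv_nonneg_of_isLocalMin hx.neg hh.neg v

end SecondDerivativeTest

section LinearAlgebra

theorem sum_mul_apply_nonneg_of_posSemidef {ι V : Type*} [Fintype ι] [AddCommGroup V] [Module ℝ V]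
    {A : Matrix ι ι ℝ} (hA : A.PosSemidef) {Q : V →ₗ[ℝ] V →ₗ[ℝ] ℝ} (hQ : ∀ v, 0 ≤ Q v v)
    (e : ι → V) : 0 ≤ ∑ i, ∑ j, A i j * Q (e i) (e j) := by
  obtain ⟨r, c, rfl⟩ := Matrix.posSemidef_iff_eq_sum_vecMulVec.1 hA
  calc 0 ≤ ∑ l, Q (∑ i, c l i • e i) (∑ j, c l j • e j) := Finset.sum_nonneg fun l _ => hQ _
    _ = ∑ l, ∑ i, ∑ j, c l i * c l j * Q (e i) (e j) := by
      simp only [map_sum, map_smul, LinearMap.sum_apply, LinearMap.smul_apply, smul_eq_mul,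
        Finset.mul_sum, mul_assoc]
      refine Finset.sum_congr rfl fun l _ => ?_
      rw [Finset.sum_comm]
      simp only [mul_left_comm]
    _ = _ := by
      simp only [Matrix.sum_apply, Matrix.vecMulVec_apply, star_trivial,
        Finset.sum_mul]
      rw [Finset.sum_comm]
      exact Finset.sum_congr rfl fun i _ => Finset.sum_comm

theorem isInvertible_of_separatingLeft {V : Type*} [NormedAddCommGroup V] [NormedSpace ℝ V]
    [FiniteDimensional ℝ V] {B : V →L[ℝ] V →L[ℝ] ℝ} (hB : ∀ v, (∀ w, B v w = 0) → v = 0) :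
    B.IsInvertible := by
  have hinj : Function.Injective (B : V →ₗ[ℝ] V →L[ℝ] ℝ) :=
    (injective_iff_map_eq_zero _).2 fun v hv => hB v fun w => congr($hv w)
  have hrank : Module.finrank ℝ V = Module.finrank ℝ (V →L[ℝ] ℝ) :=
    (Subspace.dual_finrank_eq (K := ℝ) (V := V)).symm.trans
      (LinearMap.toContinuousLinearMap : (V →ₗ[ℝ] ℝ) ≃ₗ[ℝ] V →L[ℝ] ℝ).finrank_eq
  exact ⟨(LinearEquiv.ofInjectiveOfFinrankEq _ hinj hrank).toContinuousLinearEquiv, rfl⟩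

end LinearAlgebra

section ContinuousLinearMaps

variable {𝕜 D V W : Type*} [NontriviallyNormedField 𝕜] [NormedAddCommGroup D] [NormedSpace 𝕜 D]
  [NormedAddCommGroup V] [NormedSpace 𝕜 V] [NormedAddCommGroup W] [NormedSpace 𝕜 W] {x : D}

theorem differentiableAt_of_clm_apply [CompleteSpace 𝕜] [FiniteDimensional 𝕜 V]
    {A : D → V →L[𝕜] W} (hA : ∀ v, DifferentiableAt 𝕜 (fun y => A y v) x) :
    DifferentiableAt 𝕜 A x := by
  let e : V ≃L[𝕜] (Fin (Module.finrank 𝕜 V) → 𝕜) :=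
    ContinuousLinearEquiv.ofFinrankEq (Module.finrank_fin_fun 𝕜).symm
  let coords : (V →L[𝕜] W) ≃L[𝕜] (Fin (Module.finrank 𝕜 V) → W) :=
    (e.arrowCongr (1 : W ≃L[𝕜] W)).trans (ContinuousLinearEquiv.piRing _)
  have hcoords : DifferentiableAt 𝕜 (fun y => coords (A y)) x :=
    differentiableAt_pi.2 fun i => hA _
  simpa [Function.comp_def] using coords.symm.differentiableAt.comp x hcoords

theorem fderiv_apply_apply {B : D → V →L[𝕜] V →L[𝕜] W} (hB : DifferentiableAt 𝕜 B x)
    (u : D) (v w : V) : fderiv 𝕜 B x u v w = fderiv 𝕜 (fun y => B y v w) x u := by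
  simp [((hB.hasFDerivAt.clm_apply (hasFDerivAt_const v x)).clm_apply
    (hasFDerivAt_const w x)).fderiv]

end ContinuousLinearMaps

section Chart

open Bundle

variable {E H N : Type*} [NormedAddCommGroup E] [NormedSpace ℝ E] [TopologicalSpace H]
  [TopologicalSpace N] [ChartedSpace H N] {I : ModelWithCorners ℝ E H} [I.Boundaryless]
  [IsManifold I 1 N]

theorem MetricTensor.inChart_self (g : MetricTensor I N) (q : N) (v w : E) :
    g.inChart q (extChartAt I q q) v w = g q v w := by
  have hfoot : ∀ x, x = q → ∀ a b : E, g x a b = g q a b := by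
    rintro x rfl a b; rfl
  have hid : ∀ u : E, (mfderiv 𝓘(ℝ, E) I (extChartAt I q).symm (extChartAt I q q) :
      E →L[ℝ] E) u = u := by
    have h := mfderivWithin_range_extChartAt_symm (I := I) (x := q)
    rw [I.range_eq_univ, mfderivWithin_univ] at h
    exact fun u => congrArg (fun A : E →L[ℝ] E => A u) h
  refine (hfoot _ (extChartAt_to_inv q) _ _).trans ?_
  exact congrArg₂ (fun a b : E => g q a b) (hid v) (hid w)

theorem MetricTensor.apply_christoffel (g : MetricTensor I N) {q : N}
    (hg : (g.inChart q (extChartAt I q q)).IsInvertible) (v w z : E) :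
    g q (g.christoffel q v w) z =
      (1 / 2 : ℝ) * (fderiv ℝ (g.inChart q) (extChartAt I q q) v w z +
        fderiv ℝ (g.inChart q) (extChartAt I q q) w v z -
        fderiv ℝ (g.inChart q) (extChartAt I q q) z v w) :=
  (g.inChart_self q _ z).symm.trans
    (congrArg (fun φ : E →L[ℝ] ℝ => φ z) (hg.self_apply_inverse _))

theorem MetricTensor.differentiableAt_inChart {g : MetricTensor I N} {q : N}
    (hg : ContMDiffAt I (I.prod 𝓘(ℝ, E →L[ℝ] E →L[ℝ] ℝ)) 1 (fun x =>
      TotalSpace.mk' (E →L[ℝ] E →L[ℝ] ℝ)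
        (E := fun x : N => TangentSpace I x →L[ℝ] TangentSpace I x →L[ℝ] ℝ) x (g x)) q) :
    DifferentiableAt ℝ (g.inChart q) (extChartAt I q q) := by
  have hsymm : ContMDiffAt 𝓘(ℝ, E) I 1 (extChartAt I q).symm (extChartAt I q q) :=
    (contMDiffOn_extChartAt_symm q).contMDiffAt (extChartAt_target_mem_nhds q)
  have hcoords := ContMDiffAt.comp_of_eq (x := extChartAt I q q)
    ((contMDiffAt_hom_bundle _).1 hg).2 hsymm (extChartAt_to_inv q)
  refine (hcoords.contDiffAt.differentiableAt one_ne_zero).congr_of_eventuallyEq ?_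
  filter_upwards [extChartAt_target_mem_nhds (I := I) q] with y hy
  have hy' : (extChartAt I q).symm y ∈ (chartAt H q).source := by
    simpa only [extChartAt_source] using (extChartAt I q).map_target hy
  have htriv : ∀ u : E, (trivializationAt E (TangentSpace I) q).symm ((extChartAt I q).symm y) u =
      (mfderiv 𝓘(ℝ, E) I (extChartAt I q).symm y : E →L[ℝ] E) u := by
    have h := TangentBundle.symmL_trivializationAt (𝕜 := ℝ) (I := I) hy'
    rw [I.range_eq_univ, mfderivWithin_univ, (extChartAt I q).right_inv hy] at h
    intro u
    rw [← Trivialization.symmL_apply (R := ℝ) _ (by simpa using hy')]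
    exact congrArg (fun A : E →L[ℝ] E => A u) h
  ext v w
  rw [Function.comp_apply, inCoordinates_apply_eq₂ (by simpa using hy') (by simpa using hy')
    (mem_univ _), htriv, htriv]
  simp only [Trivial.fiberBundle_trivializationAt', Trivial.linearMapAt_trivialization]
  rfl

end Chart

section Submanifold

variable {E H N : Type*} [NormedAddCommGroup E] [NormedSpace ℝ E] [TopologicalSpace H]
  [TopologicalSpace N] [ChartedSpace H N] {I : ModelWithCorners ℝ E H} {g : MetricTensor I N}
  {k : ℕ} {M : Type*} [TopologicalSpace M] [ChartedSpace (EuclideanSpace ℝ (Fin k)) M]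
  {ψ : M → N} {p : M}

theorem contDiffAt_writtenInExtChartAt {n : ℕ∞ω} (hψ : ContMDiffAt (𝓡 k) I n ψ p) :
    ContDiffAt ℝ n (writtenInExtChartAt (𝓡 k) I p ψ) (extChartAt (𝓡 k) p p) := by
  simpa only [ModelWithCorners.range_eq_univ, contDiffWithinAt_univ] using! (contMDiffAt_iff.1 hψ).2

theorem mfderiv_eq_fderiv_writtenInExtChartAt (hψ : MDifferentiableAt (𝓡 k) I ψ p) :
    (mfderiv (𝓡 k) I ψ p : EuclideanSpace ℝ (Fin k) →L[ℝ] E) =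
      fderiv ℝ (writtenInExtChartAt (𝓡 k) I p ψ) (extChartAt (𝓡 k) p p) := by
  refine hψ.mfderiv.trans ?_
  rw [ModelWithCorners.range_eq_univ, fderivWithin_univ]

variable (g ψ p) in
/-- The trace `∑ g^{ij} Q(∂_i, ∂_j)` of a bilinear form `Q` on `T_p M` with respect to the induced
metric `ψ^* g`. -/
noncomputable def inducedTrace
    (Q : EuclideanSpace ℝ (Fin k) →L[ℝ] EuclideanSpace ℝ (Fin k) →L[ℝ] ℝ) : ℝ :=
  ∑ i, ∑ j, (inducedGram (k := k) g ψ p)⁻¹ i j * Q (coordVec p i) (coordVec p j)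

theorem posDef_inducedGram (hg : ∀ v w, g (ψ p) v w = g (ψ p) w v)
    (hψ : IsSpacelikeImmersion (k := k) g ψ) : (inducedGram (k := k) g ψ p).PosDef := by
  let dψ : EuclideanSpace ℝ (Fin k) →L[ℝ] E := mfderiv (𝓡 k) I ψ p
  let b : E →L[ℝ] E →L[ℝ] ℝ := g (ψ p)
  let B : LinearMap.BilinForm ℝ (EuclideanSpace ℝ (Fin k)) := (b.bilinearComp dψ dψ).toBilinForm
  have hpos : B.toQuadraticMap.PosDef := hψ.2 p
  have hgram : inducedGram (k := k) g ψ p =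
      B.toMatrix (EuclideanSpace.basisFun (Fin k) ℝ).toBasis := by
    ext i j
    rw [LinearMap.BilinForm.toMatrix_apply]
    simp only [OrthonormalBasis.coe_toBasis, EuclideanSpace.basisFun_apply]
    rfl
  rw [hgram]
  exact (LinearMap.BilinForm.posDef_toQuadraticMap_iff_matrix _ B ⟨fun u v => hg _ _⟩).1 hpos

theorem inducedTrace_nonneg (hg : ∀ v w, g (ψ p) v w = g (ψ p) w v)
    (hψ : IsSpacelikeImmersion (k := k) g ψ)
    {Q : EuclideanSpace ℝ (Fin k) →L[ℝ] EuclideanSpace ℝ (Fin k) →L[ℝ] ℝ}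
    (hQ : ∀ u, 0 ≤ Q u u) : 0 ≤ inducedTrace g ψ p Q :=
  sum_mul_apply_nonneg_of_posSemidef (Q := Q.toLinearMap₁₂)
    (posDef_inducedGram hg hψ).inv.posSemidef hQ _

theorem inducedTrace_nonpos (hg : ∀ v w, g (ψ p) v w = g (ψ p) w v)
    (hψ : IsSpacelikeImmersion (k := k) g ψ)
    {Q : EuclideanSpace ℝ (Fin k) →L[ℝ] EuclideanSpace ℝ (Fin k) →L[ℝ] ℝ}
    (hQ : ∀ u, Q u u ≤ 0) : inducedTrace g ψ p Q ≤ 0 := by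
  have hneg : inducedTrace g ψ p (-Q) = -inducedTrace g ψ p Q := by
    have hentry : ∀ i j, (-Q) (coordVec p i) (coordVec p j) = -Q (coordVec p i) (coordVec p j) :=
      fun _ _ => rfl
    simp only [inducedTrace, hentry, mul_neg, Finset.sum_neg_distrib]
  exact neg_nonneg.1 (hneg ▸ inducedTrace_nonneg hg hψ fun u => neg_nonneg.2 (hQ u))

section NormalForm

variable {ℓ : TangentSpace I (ψ p) →L[ℝ] ℝ} (hℓ : ∀ u, ℓ (mfderiv (𝓡 k) I ψ p u) = 0)
include hℓ

theorem apply_secondFundamentalForm_of_normal (u v : TangentSpace (𝓡 k) p) :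
    ℓ (secondFundamentalForm (k := k) g ψ p u v) =
      -ℓ (ambientCovDeriv (k := k) g ψ p u v) := by
  simp only [secondFundamentalForm, normalPart, map_neg, map_sub, map_sum, map_smul, hℓ, smul_zero,
    Finset.sum_const_zero, sub_zero]

theorem apply_meanCurvature_of_normal
    {Q : EuclideanSpace ℝ (Fin k) →L[ℝ] EuclideanSpace ℝ (Fin k) →L[ℝ] ℝ}
    (hQ : ∀ u v, ℓ (ambientCovDeriv (k := k) g ψ p u v) = Q u v) :
    ℓ (meanCurvature (k := k) g ψ p) = -(1 / k * inducedTrace g ψ p Q) := by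
  have hII : ∀ i j, ℓ (secondFundamentalForm (k := k) g ψ p (coordVec p i) (coordVec p j)) =
      -Q (coordVec p i) (coordVec p j) := fun i j =>
    (apply_secondFundamentalForm_of_normal hℓ _ _).trans (congrArg Neg.neg (hQ _ _))
  simp only [meanCurvature, map_sum, map_smul, hII, smul_eq_mul, mul_neg, Finset.sum_neg_distrib,
    inducedTrace]

end NormalForm

theorem apply_ambientCovDeriv (hψ : ContMDiffAt (𝓡 k) I 2 ψ p) (ℓ : E →L[ℝ] ℝ)
    (u v : EuclideanSpace ℝ (Fin k)) :
    ℓ (ambientCovDeriv (k := k) g ψ p u v) =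
      fderiv ℝ (fderiv ℝ (ℓ ∘ writtenInExtChartAt (𝓡 k) I p ψ)) (extChartAt (𝓡 k) p p) u v +
        ℓ (g.christoffel (ψ p) (mfderiv (𝓡 k) I ψ p u) (mfderiv (𝓡 k) I ψ p v)) := by
  set Ψ : EuclideanSpace ℝ (Fin k) → E := writtenInExtChartAt (𝓡 k) I p ψ
  set x := extChartAt (𝓡 k) p p
  have hsmooth : ContDiffAt ℝ 2 Ψ x := contDiffAt_writtenInExtChartAt hψ
  have hd : DifferentiableAt ℝ (fderiv ℝ Ψ) x :=
    (hsmooth.fderiv_right (m := 1) (by norm_num)).differentiableAt one_ne_zero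
  have hfirst : fderiv ℝ (ℓ ∘ Ψ) =ᶠ[𝓝 x] fun y => ℓ.comp (fderiv ℝ Ψ y) := by
    filter_upwards [hsmooth.eventually (by simp)] with y hy
    exact (ℓ.hasFDerivAt.comp y (hy.differentiableAt two_ne_zero).hasFDerivAt).fderiv
  have hsecond : fderiv ℝ (fderiv ℝ (ℓ ∘ Ψ)) x u v = ℓ (fderiv ℝ (fderiv ℝ Ψ) x u v) := by
    rw [hfirst.fderiv_eq, ((hasFDerivAt_const ℓ x).clm_comp hd.hasFDerivAt).fderiv]
    simp
  have hconst : fderiv ℝ (fun y => fderiv ℝ Ψ y v) x u = fderiv ℝ (fderiv ℝ Ψ) x u v := by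
    simp [fderiv_clm_apply hd (differentiableAt_const v)]
  rw [hsecond, ← hconst]
  exact map_add ℓ _ _

end Submanifold

namespace GRWSpacetime

section Charts

variable {m : ℕ} {F : Type*} [TopologicalSpace F] [ChartedSpace (EuclideanSpace ℝ (Fin m)) F]

theorem extChartAt_eq_prod (q : ℝ × F) :
    extChartAt (𝓘(ℝ, ℝ).prod (𝓡 m)) q = (PartialEquiv.refl ℝ).prod (extChartAt (𝓡 m) q.2) := by
  rw [extChartAt_prod, extChartAt_model_space_eq_id]

theorem extChartAt_apply_self (q : ℝ × F) :
    extChartAt (𝓘(ℝ, ℝ).prod (𝓡 m)) q q = (q.1, extChartAt (𝓡 m) q.2 q.2) := by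
  rw [extChartAt_eq_prod]
  rfl

theorem eventually_snd_mem_extChartAt_target (q : ℝ × F) :
    ∀ᶠ y : ℝ × EuclideanSpace ℝ (Fin m) in 𝓝 (extChartAt (𝓘(ℝ, ℝ).prod (𝓡 m)) q q),
      y.2 ∈ (extChartAt (𝓡 m) q.2).target := by
  rw [extChartAt_apply_self]
  exact continuousAt_snd.eventually (extChartAt_target_mem_nhds (I := 𝓡 m) q.2)

theorem mfderiv_extChartAt_symm_apply [IsManifold (𝓡 m) 1 F] (q : ℝ × F)
    {y : ℝ × EuclideanSpace ℝ (Fin m)} (hy : y.2 ∈ (extChartAt (𝓡 m) q.2).target)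
    (u : ℝ × EuclideanSpace ℝ (Fin m)) :
    (mfderiv 𝓘(ℝ, ℝ × EuclideanSpace ℝ (Fin m)) (𝓘(ℝ, ℝ).prod (𝓡 m))
        (extChartAt (𝓘(ℝ, ℝ).prod (𝓡 m)) q).symm y : _ →L[ℝ] ℝ × EuclideanSpace ℝ (Fin m)) u =
      (u.1, (mfderiv 𝓘(ℝ, EuclideanSpace ℝ (Fin m)) (𝓡 m)
        (extChartAt (𝓡 m) q.2).symm y.2 : _ →L[ℝ] EuclideanSpace ℝ (Fin m)) u.2) := by
  have hfiber : MDifferentiableAt 𝓘(ℝ, EuclideanSpace ℝ (Fin m)) (𝓡 m)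
      (extChartAt (𝓡 m) q.2).symm y.2 := by
    simpa only [ModelWithCorners.range_eq_univ, mdifferentiableWithinAt_univ] using
      mdifferentiableWithinAt_extChartAt_symm hy
  have hsymm : ((extChartAt (𝓘(ℝ, ℝ).prod (𝓡 m)) q).symm : _ → ℝ × F) =
      Prod.map id (extChartAt (𝓡 m) q.2).symm := by
    rw [extChartAt_eq_prod]
    rfl
  rw [hsymm, modelWithCornersSelf_prod, ← chartedSpaceSelf_prod,
    mfderiv_prodMap mdifferentiableAt_id hfiber, mfderiv_id]
  rfl

end Charts

section Metric

variable {m : ℕ} {F : Type*} [TopologicalSpace F] [ChartedSpace (EuclideanSpace ℝ (Fin m)) F]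
  [IsManifold (𝓡 m) ∞ F] (S : GRWSpacetime m F)

theorem metric_apply (q : ℝ × F) (v w : ℝ × EuclideanSpace ℝ (Fin m)) :
    S.metric q v w = -(v.1 * w.1) + S.f q.1 ^ 2 * S.gF.inner q.2 v.2 w.2 := by
  simp only [metric, mfderiv_fst, mfderiv_snd]
  rfl

theorem metric_symm (q : ℝ × F) (v w : TangentSpace (𝓘(ℝ, ℝ).prod (𝓡 m)) q) :
    S.metric q v w = S.metric q w v := by
  rw [S.metric_apply q v w, S.metric_apply q w v, mul_comm]
  exact congrArg (fun s => _ + S.f q.1 ^ 2 * s) (S.gF.symm q.2 _ _)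

theorem inner_self_nonneg (x : F) (v : TangentSpace (𝓡 m) x) : 0 ≤ S.gF.inner x v v := by
  obtain rfl | hv := eq_or_ne v 0
  · simp
  · exact (S.gF.pos x v hv).le

theorem differentiableAt_f {t : ℝ} (ht : t ∈ S.I) : DifferentiableAt ℝ S.f t :=
  (S.contDiffOn_f.differentiableOn (by simp)).differentiableAt (S.isOpen_I.mem_nhds ht)

theorem inChart_metric (q : ℝ × F) {y : ℝ × EuclideanSpace ℝ (Fin m)}
    (hy : y.2 ∈ (extChartAt (𝓡 m) q.2).target) (v w : ℝ × EuclideanSpace ℝ (Fin m)) :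
    MetricTensor.inChart S.metric q y v w = -(v.1 * w.1) +
      S.f y.1 ^ 2 * MetricTensor.inChart (I := 𝓡 m) S.gF.inner q.2 y.2 v.2 w.2 := by
  have : IsManifold (𝓡 m) 1 F := IsManifold.of_le (n := ∞) (by simp)
  have hsymm : (extChartAt (𝓘(ℝ, ℝ).prod (𝓡 m)) q).symm y =
      (y.1, (extChartAt (𝓡 m) q.2).symm y.2) := by
    rw [extChartAt_eq_prod]
    rfl
  have hfoot : ∀ x x' : ℝ × F, x = x' → ∀ a b : ℝ × EuclideanSpace ℝ (Fin m),
      S.metric x a b = S.metric x' a b := by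
    rintro x _ rfl a b; rfl
  refine (hfoot _ _ hsymm _ _).trans ?_
  refine (congrArg₂ (fun a b => S.metric (y.1, (extChartAt (𝓡 m) q.2).symm y.2) a b)
    (mfderiv_extChartAt_symm_apply q hy v) (mfderiv_extChartAt_symm_apply q hy w)).trans ?_
  exact S.metric_apply _ _ _

theorem isInvertible_inChart_metric {q : ℝ × F} (hq : q.1 ∈ S.I) :
    (MetricTensor.inChart S.metric q (extChartAt (𝓘(ℝ, ℝ).prod (𝓡 m)) q q)).IsInvertible := by
  have : IsManifold (𝓡 m) 1 F := IsManifold.of_le (n := ∞) (by simp)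
  refine isInvertible_of_separatingLeft fun v hv => ?_
  have hreflect : 0 = v.1 * v.1 + S.f q.1 ^ 2 * S.gF.inner q.2 v.2 v.2 := by
    rw [← hv (-v.1, v.2), MetricTensor.inChart_self, metric_apply]
    simp
  have hsnd : v.2 = 0 := by
    by_contra hne
    have := mul_pos (pow_pos (S.f_pos _ hq) 2) (S.gF.pos q.2 v.2 hne)
    linarith [mul_self_nonneg v.1]
  have hfst : v.1 = 0 := by
    have := mul_nonneg (sq_nonneg (S.f q.1)) (S.inner_self_nonneg q.2 v.2)
    exact mul_self_eq_zero.1 (by linarith [mul_self_nonneg v.1])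
  exact Prod.ext hfst hsnd

theorem differentiableAt_inChart_metric {q : ℝ × F} (hq : q.1 ∈ S.I) :
    DifferentiableAt ℝ (MetricTensor.inChart S.metric q)
      (extChartAt (𝓘(ℝ, ℝ).prod (𝓡 m)) q q) := by
  have : IsManifold (𝓡 m) 1 F := IsManifold.of_le (n := ∞) (by simp)
  have hf : DifferentiableAt ℝ (fun y : ℝ × EuclideanSpace ℝ (Fin m) => S.f y.1)
      (extChartAt (𝓘(ℝ, ℝ).prod (𝓡 m)) q q) := by
    rw [extChartAt_apply_self]
    exact DifferentiableAt.comp (g := S.f) _ (S.differentiableAt_f hq) differentiableAt_fst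
  have hgF : DifferentiableAt ℝ (MetricTensor.inChart (I := 𝓡 m) S.gF.inner q.2)
      (extChartAt (𝓡 m) q.2 q.2) :=
    MetricTensor.differentiableAt_inChart ((S.gF.contMDiff q.2).of_le (by simp))
  refine differentiableAt_of_clm_apply fun v => differentiableAt_of_clm_apply fun w => ?_
  have hgF_vw : DifferentiableAt ℝ (fun y : ℝ × EuclideanSpace ℝ (Fin m) =>
      MetricTensor.inChart (I := 𝓡 m) S.gF.inner q.2 y.2 v.2 w.2)
      (extChartAt (𝓘(ℝ, ℝ).prod (𝓡 m)) q q) := by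
    rw [extChartAt_apply_self]
    have hcoeff := (hgF.clm_apply (differentiableAt_const v.2)).clm_apply
      (differentiableAt_const w.2)
    exact DifferentiableAt.comp (f := Prod.snd)
      (g := fun y => MetricTensor.inChart (I := 𝓡 m) S.gF.inner q.2 y v.2 w.2) _ hcoeff
      differentiableAt_snd
  have hvw : DifferentiableAt ℝ (fun y : ℝ × EuclideanSpace ℝ (Fin m) => -(v.1 * w.1) +
      S.f y.1 ^ 2 * MetricTensor.inChart (I := 𝓡 m) S.gF.inner q.2 y.2 v.2 w.2)
      (extChartAt (𝓘(ℝ, ℝ).prod (𝓡 m)) q q) := ((hf.pow 2).mul hgF_vw).const_add _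
  refine hvw.congr_of_eventuallyEq ?_
  filter_upwards [eventually_snd_mem_extChartAt_target q] with y hy
  exact S.inChart_metric q hy v w

theorem fderiv_inChart_metric_apply_dt {q : ℝ × F} (hq : q.1 ∈ S.I)
    (u v : ℝ × EuclideanSpace ℝ (Fin m)) :
    fderiv ℝ (MetricTensor.inChart S.metric q) (extChartAt (𝓘(ℝ, ℝ).prod (𝓡 m)) q q) u v
      (1, 0) = 0 := by
  have hconst : (fun y => MetricTensor.inChart S.metric q y v (1, 0))
      =ᶠ[𝓝 (extChartAt (𝓘(ℝ, ℝ).prod (𝓡 m)) q q)] fun _ => -v.1 := by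
    filter_upwards [eventually_snd_mem_extChartAt_target q] with y hy
    rw [S.inChart_metric q hy]
    simp
  rw [fderiv_apply_apply (S.differentiableAt_inChart_metric hq), hconst.fderiv_eq]
  simp

theorem fderiv_inChart_metric_dt {q : ℝ × F} (hq : q.1 ∈ S.I)
    (v w : ℝ × EuclideanSpace ℝ (Fin m)) :
    fderiv ℝ (MetricTensor.inChart S.metric q) (extChartAt (𝓘(ℝ, ℝ).prod (𝓡 m)) q q) (1, 0) v w =
      2 * S.f q.1 * deriv S.f q.1 * S.gF.inner q.2 v.2 w.2 := by
  have : IsManifold (𝓡 m) 1 F := IsManifold.of_le (n := ∞) (by simp)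
  have hB := S.differentiableAt_inChart_metric hq
  have hline : (fun s : ℝ => MetricTensor.inChart S.metric q
      (extChartAt (𝓘(ℝ, ℝ).prod (𝓡 m)) q q + s • (1, 0)) v w) =
      fun s => -(v.1 * w.1) + S.f (q.1 + s) ^ 2 * S.gF.inner q.2 v.2 w.2 := by
    funext s
    have hpoint : (q.1, extChartAt (𝓡 m) q.2 q.2) + s • (1, 0) =
        (q.1 + s, extChartAt (𝓡 m) q.2 q.2) := by simp
    rw [extChartAt_apply_self, hpoint, S.inChart_metric q (mem_extChartAt_target q.2),
      MetricTensor.inChart_self]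
  have hf : HasDerivAt S.f (deriv S.f q.1) (q.1 + 0) := by
    simpa using (S.differentiableAt_f hq).hasDerivAt
  have hderiv := (((hf.comp_const_add q.1 0).fun_pow 2).mul_const
    (S.gF.inner q.2 v.2 w.2)).const_add (-(v.1 * w.1))
  rw [← hline] at hderiv
  have hdir : HasLineDerivAt ℝ (fun y => MetricTensor.inChart S.metric q y v w) _ _ (1, 0) :=
    hderiv
  have hvw : DifferentiableAt ℝ (fun y => MetricTensor.inChart S.metric q y v w)
      (extChartAt (𝓘(ℝ, ℝ).prod (𝓡 m)) q q) :=
    (hB.clm_apply (differentiableAt_const v)).clm_apply (differentiableAt_const w)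
  rw [fderiv_apply_apply hB, ← hvw.lineDeriv_eq_fderiv, hdir.lineDeriv]
  simp

theorem metric_christoffel_dt {q : ℝ × F} (hq : q.1 ∈ S.I)
    (v w : ℝ × EuclideanSpace ℝ (Fin m)) :
    S.metric q (MetricTensor.christoffel (E := ℝ × EuclideanSpace ℝ (Fin m)) S.metric q v w)
      (dt q) = -(S.f q.1 * deriv S.f q.1 * S.gF.inner q.2 v.2 w.2) := by
  have : IsManifold (𝓡 m) 1 F := IsManifold.of_le (n := ∞) (by simp)
  refine (MetricTensor.apply_christoffel S.metric (S.isInvertible_inChart_metric hq) v w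
    (1, 0)).trans ?_
  rw [S.fderiv_inChart_metric_apply_dt hq, S.fderiv_inChart_metric_apply_dt hq,
    S.fderiv_inChart_metric_dt hq]
  ring

end Metric

section TimeFunction

variable {k m : ℕ} {F M : Type*} [TopologicalSpace M] [ChartedSpace (EuclideanSpace ℝ (Fin k)) M]
  {ψ : M → ℝ × F} {p : M}

variable (ψ p) in
/-- The time function `τ = π_I ∘ ψ` along `ψ`, in the preferred chart at `p`. -/
noncomputable def timeInChart (x : EuclideanSpace ℝ (Fin k)) : ℝ :=
  (ψ ((extChartAt (𝓡 k) p).symm x)).1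

theorem isLocalMin_timeInChart (hp : ∀ x, (ψ p).1 ≤ (ψ x).1) :
    IsLocalMin (timeInChart (k := k) ψ p) (extChartAt (𝓡 k) p p) :=
  Eventually.of_forall fun x => by
    simpa only [timeInChart, extChartAt_to_inv] using hp _

theorem isLocalMax_timeInChart (hp : ∀ x, (ψ x).1 ≤ (ψ p).1) :
    IsLocalMax (timeInChart (k := k) ψ p) (extChartAt (𝓡 k) p p) :=
  Eventually.of_forall fun x => by
    simpa only [timeInChart, extChartAt_to_inv] using hp _

variable [TopologicalSpace F] [ChartedSpace (EuclideanSpace ℝ (Fin m)) F]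

variable (ψ p) in
theorem fst_comp_writtenInExtChartAt :
    ContinuousLinearMap.fst ℝ ℝ (EuclideanSpace ℝ (Fin m)) ∘
      writtenInExtChartAt (𝓡 k) (𝓘(ℝ, ℝ).prod (𝓡 m)) p ψ = timeInChart ψ p := by
  rw [writtenInExtChartAt, extChartAt_eq_prod]
  rfl

theorem contDiffAt_timeInChart {n : ℕ∞ω}
    (hψ : ContMDiffAt (𝓡 k) (𝓘(ℝ, ℝ).prod (𝓡 m)) n ψ p) :
    ContDiffAt ℝ n (timeInChart (k := k) ψ p) (extChartAt (𝓡 k) p p) := by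
  rw [← fst_comp_writtenInExtChartAt (m := m)]
  exact (contDiffAt_writtenInExtChartAt hψ).fst

/-- The differential `dt` of the time function `(t, x) ↦ t`. -/
noncomputable def timeForm (q : ℝ × F) : TangentSpace (𝓘(ℝ, ℝ).prod (𝓡 m)) q →L[ℝ] ℝ :=
  (ContinuousLinearMap.fst ℝ ℝ (EuclideanSpace ℝ (Fin m)) :
    ℝ × EuclideanSpace ℝ (Fin m) →L[ℝ] ℝ)

theorem timeForm_mfderiv (hψ : ContMDiffAt (𝓡 k) (𝓘(ℝ, ℝ).prod (𝓡 m)) 1 ψ p)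
    (u : EuclideanSpace ℝ (Fin k)) :
    timeForm (ψ p) (mfderiv (𝓡 k) (𝓘(ℝ, ℝ).prod (𝓡 m)) ψ p u) =
      fderiv ℝ (timeInChart (k := k) ψ p) (extChartAt (𝓡 k) p p) u := by
  have hchain := ((ContinuousLinearMap.fst ℝ ℝ (EuclideanSpace ℝ (Fin m))).hasFDerivAt.comp _
    ((contDiffAt_writtenInExtChartAt hψ).differentiableAt one_ne_zero).hasFDerivAt).fderiv
  rw [fst_comp_writtenInExtChartAt] at hchain
  rw [hchain, ← mfderiv_eq_fderiv_writtenInExtChartAt (hψ.mdifferentiableAt one_ne_zero)]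
  rfl

end TimeFunction

section MeanCurvature

variable {m : ℕ} {F : Type*} [TopologicalSpace F] [ChartedSpace (EuclideanSpace ℝ (Fin m)) F]
  [IsManifold (𝓡 m) ∞ F] (S : GRWSpacetime m F)
  {k : ℕ} {M : Type*} [TopologicalSpace M] [ChartedSpace (EuclideanSpace ℝ (Fin k)) M]
  {ψ : M → ℝ × F} {p : M}

theorem metric_apply_dt (q : ℝ × F) (v : TangentSpace (𝓘(ℝ, ℝ).prod (𝓡 m)) q) :
    S.metric q v (dt q) = -timeForm q v := by
  refine (S.metric_apply q v (1, 0)).trans ?_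
  have hfiber : S.gF.inner q.2 (v : ℝ × EuclideanSpace ℝ (Fin m)).2
      (0 : EuclideanSpace ℝ (Fin m)) = 0 := map_zero (S.gF.inner q.2 _)
  simp only [hfiber, mul_zero, mul_one, add_zero]
  rfl

variable (ψ p) in
/-- The time component `Hess τ + f f' ψ^* g_F` of the ambient covariant derivative along `ψ`,
where `Hess τ` is the Hessian of the time function in the preferred chart at `p`. -/
noncomputable def timeCovDeriv :
    EuclideanSpace ℝ (Fin k) →L[ℝ] EuclideanSpace ℝ (Fin k) →L[ℝ] ℝ :=
  let dψ : EuclideanSpace ℝ (Fin k) →L[ℝ] ℝ × EuclideanSpace ℝ (Fin m) :=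
    mfderiv (𝓡 k) (𝓘(ℝ, ℝ).prod (𝓡 m)) ψ p
  let dψF : EuclideanSpace ℝ (Fin k) →L[ℝ] EuclideanSpace ℝ (Fin m) :=
    (ContinuousLinearMap.snd ℝ ℝ (EuclideanSpace ℝ (Fin m))).comp dψ
  let gF : EuclideanSpace ℝ (Fin m) →L[ℝ] EuclideanSpace ℝ (Fin m) →L[ℝ] ℝ :=
    S.gF.inner (ψ p).2
  fderiv ℝ (fderiv ℝ (timeInChart (k := k) ψ p)) (extChartAt (𝓡 k) p p) +
    (S.f (ψ p).1 * deriv S.f (ψ p).1) • gF.bilinearComp dψF dψF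

theorem timeForm_ambientCovDeriv (hψ : ContMDiffAt (𝓡 k) (𝓘(ℝ, ℝ).prod (𝓡 m)) 2 ψ p)
    (hp : (ψ p).1 ∈ S.I) (u v : EuclideanSpace ℝ (Fin k)) :
    timeForm (ψ p) (ambientCovDeriv (k := k) S.metric ψ p u v) = S.timeCovDeriv ψ p u v := by
  refine (apply_ambientCovDeriv hψ
    (ContinuousLinearMap.fst ℝ ℝ (EuclideanSpace ℝ (Fin m))) u v).trans ?_
  rw [fst_comp_writtenInExtChartAt]
  refine congrArg (_ + ·) ?_
  exact neg_injective ((S.metric_apply_dt (ψ p) _).symm.trans (S.metric_christoffel_dt hp _ _))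

theorem metric_meanCurvature_dt (hψ : ContMDiffAt (𝓡 k) (𝓘(ℝ, ℝ).prod (𝓡 m)) 2 ψ p)
    (hp : (ψ p).1 ∈ S.I)
    (hcrit : fderiv ℝ (timeInChart (k := k) ψ p) (extChartAt (𝓡 k) p p) = 0) :
    S.metric (ψ p) (meanCurvature (k := k) S.metric ψ p) (dt (ψ p)) =
      1 / k * inducedTrace (k := k) S.metric ψ p (S.timeCovDeriv ψ p) := by
  have htangent : ∀ u : TangentSpace (𝓡 k) p,
      timeForm (ψ p) (mfderiv (𝓡 k) (𝓘(ℝ, ℝ).prod (𝓡 m)) ψ p u) = 0 := fun u =>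
    (timeForm_mfderiv (k := k) (hψ.of_le one_le_two) u).trans congr($hcrit u)
  rw [metric_apply_dt, apply_meanCurvature_of_normal htangent (S.timeForm_ambientCovDeriv hψ hp),
    neg_neg]

theorem metric_meanCurvature_dt_nonneg (hψ : S.IsSpacelikeSubmanifold (k := k) ψ)
    (hf : 0 ≤ deriv S.f (ψ p).1) (hp : ∀ x, (ψ p).1 ≤ (ψ x).1) :
    0 ≤ S.metric (ψ p) (meanCurvature (k := k) S.metric ψ p) (dt (ψ p)) := by
  have hI : (ψ p).1 ∈ S.I := (hψ.1 p).1
  have hsmooth : ContMDiffAt (𝓡 k) (𝓘(ℝ, ℝ).prod (𝓡 m)) 2 ψ p := (hψ.2.1 p).of_le (by norm_cast)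
  have hmin := isLocalMin_timeInChart (k := k) hp
  rw [S.metric_meanCurvature_dt hsmooth hI hmin.fderiv_eq_zero]
  refine mul_nonneg (by positivity)
    (inducedTrace_nonneg (S.metric_symm _) hψ.2 fun u => add_nonneg ?_ ?_)
  · exact fderiv_fderiv_nonneg_of_isLocalMin hmin (contDiffAt_timeInChart hsmooth) u
  · exact mul_nonneg (mul_nonneg (S.f_pos _ hI).le hf) (S.inner_self_nonneg _ _)

theorem metric_meanCurvature_dt_nonpos (hψ : S.IsSpacelikeSubmanifold (k := k) ψ)
    (hf : deriv S.f (ψ p).1 ≤ 0) (hp : ∀ x, (ψ x).1 ≤ (ψ p).1) :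
    S.metric (ψ p) (meanCurvature (k := k) S.metric ψ p) (dt (ψ p)) ≤ 0 := by
  have hI : (ψ p).1 ∈ S.I := (hψ.1 p).1
  have hsmooth : ContMDiffAt (𝓡 k) (𝓘(ℝ, ℝ).prod (𝓡 m)) 2 ψ p := (hψ.2.1 p).of_le (by norm_cast)
  have hmax := isLocalMax_timeInChart (k := k) hp
  rw [S.metric_meanCurvature_dt hsmooth hI hmax.fderiv_eq_zero]
  refine mul_nonpos_of_nonneg_of_nonpos (by positivity)
    (inducedTrace_nonpos (S.metric_symm _) hψ.2 fun u => add_nonpos ?_ ?_)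
  · exact fderiv_fderiv_nonpos_of_isLocalMax hmax (contDiffAt_timeInChart hsmooth) u
  · exact mul_nonpos_of_nonpos_of_nonneg (mul_nonpos_of_nonneg_of_nonpos (S.f_pos _ hI).le hf)
      (S.inner_self_nonneg _ _)

end MeanCurvature

end GRWSpacetime

theorem corollary4p2_general {m : ℕ} {F : Type*} [TopologicalSpace F]
    [ChartedSpace (EuclideanSpace ℝ (Fin m)) F] [IsManifold (𝓡 m) ∞ F] (S : GRWSpacetime m F)
    {k : ℕ} {M : Type*} [TopologicalSpace M] [ChartedSpace (EuclideanSpace ℝ (Fin k)) M]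
    [Nonempty M] [CompactSpace M] {ψ : M → ℝ × F} (hψ : S.IsSpacelikeSubmanifold (k := k) ψ) :
    (S.IsNonContracting → ∃ p, ¬ S.IsFuturePointing (meanCurvature (k := k) S.metric ψ p)) ∧
    (S.IsNonExpanding → ∃ p, ¬ S.IsPastPointing (meanCurvature (k := k) S.metric ψ p)) := by
  have hτ : Continuous fun x => (ψ x).1 := continuous_fst.comp hψ.2.1.continuous
  constructor
  · intro hS
    obtain ⟨p, -, hp⟩ := isCompact_univ.exists_isMinOn univ_nonempty hτ.continuousOn
    exact ⟨p, (S.metric_meanCurvature_dt_nonneg hψ (hS _ (hψ.1 p).1) fun x =>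
      hp (mem_univ x)).not_gt⟩
  · intro hS
    obtain ⟨p, -, hp⟩ := isCompact_univ.exists_isMaxOn univ_nonempty hτ.continuousOn
    exact ⟨p, (S.metric_meanCurvature_dt_nonpos hψ (hS _ (hψ.1 p).1) fun x =>
      hp (mem_univ x)).not_gt⟩

theorem corollary4p2 {m : ℕ} (hm : 2 ≤ m) {F : Type*} [TopologicalSpace F]
    [ChartedSpace (EuclideanSpace ℝ (Fin m)) F] [IsManifold (𝓡 m) ∞ F] [ConnectedSpace F]
    (S : GRWSpacetime m F) {k : ℕ} (hk : 1 ≤ k) {M : Type*} [TopologicalSpace M]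
    [ChartedSpace (EuclideanSpace ℝ (Fin k)) M] [IsManifold (𝓡 k) ∞ M]
    [ConnectedSpace M] [CompactSpace M] :
    (S.IsNonContracting → ¬ ∃ ψ : M → ℝ × F, S.IsWeaklyFutureTrapped (k := k) ψ) ∧
    (S.IsNonExpanding → ¬ ∃ ψ : M → ℝ × F, S.IsWeaklyPastTrapped (k := k) ψ) :=
  ⟨fun hS ⟨_, hψ, hH⟩ => ((corollary4p2_general S hψ).1 hS).elim fun p hp => hp (hH p).2,
    fun hS ⟨_, hψ, hH⟩ => ((corollary4p2_general S hψ).2 hS).elim fun p hp => hp (hH p).2⟩
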